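/- Write $\mathbb{D}=\{z\in\mathbb{C}:|z|<1\}$. For a sequence $(z_k)$ in $\mathbb{D}$, $\zeta\in\mathbb{D}$ and $t,r>0$ let $n_\zeta(t)$ be the number of indices $k$ with $|z_k-\zeta|\le t$, and let $N_\zeta(r)=\int_0^r\frac{(n_\zeta(t)-1)^+}{t}\,dt$. For a function $a$ analytic in $\mathbb{D}$ let $M(r,a)=\max\{|a(z)|:|z|=r\}$. For arbitrary $\eta_1,\eta_2>0$ there exists an (infinite) sequence $(z_k)_{k\in\mathbb{N}}$ of distinct points of $\mathbb{D}$ with the following properties: (i) there is $C>0$ such that $n_{z_k}\bigl(\tfrac{1-|z_k|}{2}\bigr)\le C\log^{\eta_1}\frac{1}{1-|z_k|}$ for all $k\in\mathbb{N}$; (ii) there is $C>0$ such that $N_{z_k}\bigl(\tfrac{1-|z_k|}{2}\bigr)\le C\log^{1+\eta_1+\eta_2}\frac{1}{1-|z_k|}$ for all $k\in\mathbb{N}$; (iii) for every real $\eta<\eta_2$ there are no functions $a$ and $f$ analytic in $\mathbb{D}$ such that $\log M(r,a)=O\bigl(\log^{1+\eta}\frac{1}{1-r}\bigr)$ as $r\to1-$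 (that is, $\log M(r,a)\le C\log^{1+\eta}\frac{1}{1-r}$ for some $C>0$ and all $r<1$ close to $1$), $f''+af=0$ in $\mathbb{D}$, and the zeros of $f$ in $\mathbb{D}$ are precisely the points $z_k$, $k\in\mathbb{N}$. -/

import Mathlib

open Set Filter Topology MeasureTheory
open scoped ENNReal

noncomputable section

/-- The number `n_ζ(t)` of members of the sequence `z` in the closed disc of radius `t` about `ζ`
(possibly infinite). -/
def countIn (z : ℕ → ℂ) (ζ : ℂ) (t : ℝ) : ℕ∞ :=
  {k : ℕ | ‖z k - ζ‖ ≤ t}.encard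

/-- The integrated counting function `N_ζ(r) = ∫_0^r (n_ζ(t) - 1)^+ / t dt`, with values
in `[0, ∞]`; subtraction in `[0, ∞]` is truncated at `0`, so it is the positive part. -/
def integratedCount (z : ℕ → ℂ) (ζ : ℂ) (r : ℝ) : ℝ≥0∞ :=
  ∫⁻ t in Ioc 0 r, ((countIn z ζ t : ℝ≥0∞) - 1) / ENNReal.ofReal t

/-- The maximum modulus `M(r, a) = max {|a(w)| : |w| = r}`. -/
def maxModulus (r : ℝ) (a : ℂ → ℂ) : ℝ :=
  sSup ((fun w => ‖a w‖) '' Metric.sphere (0 : ℂ) r)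

/-- `log M(r, a) = O(log^p (1 / (1 - r)))` as `r → 1-`, as an upper bound: no lower bound
on `log M(r, a)` is asked for, and `a = 0` (where `Real.log 0 = 0`) is admitted for every `p`. -/
def LogMaxModulusBigO (a : ℂ → ℂ) (p : ℝ) : Prop :=
  ∃ C : ℝ, 0 < C ∧ ∀ᶠ r in 𝓝[<] (1 : ℝ),
    Real.log (maxModulus r a) ≤ C * Real.log (1 / (1 - r)) ^ p

/-- `f` is an analytic solution of `f'' + a f = 0` in the unit disc. -/
def IsDiscSolution (a f : ℂ → ℂ) : Prop :=
  DifferentiableOn ℂ f (Metric.ball 0 1) ∧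
    ∀ w ∈ Metric.ball (0 : ℂ) 1, iteratedDeriv 2 f w + a w * f w = 0

/-- The zeros of `f` in the unit disc are precisely the points of the sequence `z`.
(Zeros of a nontrivial solution of `f'' + a f = 0` are simple, so multiplicities play no role.) -/
def HasZeroSequence (f : ℂ → ℂ) (z : ℕ → ℂ) : Prop :=
  {w ∈ Metric.ball (0 : ℂ) 1 | f w = 0} = range z

end

/-!
The sequence consists of pairs of points on the real axis: the `n`-th pair has its first member at
distance `s n = 4⁻⁽ⁿ⁺¹⁾` from `1`, and the two members of the pair are extremely close, at
distance `d n = exp (-4 L ^ (1 + η₂))` with `L = log (1 / s n)`. Each disc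
`|w - z k| ≤ (1 - |z k|) / 2` contains exactly one pair, so the counting function there is at
most `2`, and the integrated counting function is at most
`∫_{d n}^1 dt / t = log (1 / d n) = 4 L ^ (1 + η₂)`.

On the other hand, two zeros of a nontrivial solution of `f'' + a f = 0` at distance `d` force
`|a| ≥ 1 / (2 d²)` somewhere on the segment between them
(`one_le_of_two_zeros`, a crude complex form of the Sturm comparison theorem). By the maximum
principle `log M(r, a)` is at least a constant times `L ^ (1 + η₂)` for `r = 1 - s n / 2`, where
`log (1 / (1 - r))` is comparable with `L`, and this excludes the growth rate
`log ^ (1 + η) (1 / (1 - r))` for every `η < η₂`.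
-/

/-- If `f'' + a f = 0` on a convex open set, `f` vanishes at two points `x`, `y` but not on the
whole segment between them, and `|a| ≤ M` on that segment, then `1 ≤ 2 M |y - x|²`. Estimating
`f' - f' x` and then `f - f' x * (· - x)` by the mean value inequality bounds `max |f|` on the
segment by `2 M |y - x|² max |f|`. -/
theorem one_le_of_two_zeros {U : Set ℂ} (hU : IsOpen U) (hconv : Convex ℝ U) {a f : ℂ → ℂ}
    (hf : DifferentiableOn ℂ f U)
    (hode : ∀ w ∈ U, iteratedDeriv 2 f w + a w * f w = 0) {x y : ℂ} (hx : x ∈ U) (hy : y ∈ U)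
    (hfx : f x = 0) (hfy : f y = 0) {M : ℝ} (hM : ∀ w ∈ segment ℝ x y, ‖a w‖ ≤ M)
    {v : ℂ} (hv : v ∈ segment ℝ x y) (hfv : f v ≠ 0) :
    1 ≤ 2 * M * ‖y - x‖ ^ 2 := by
  have hsub : segment ℝ x y ⊆ U := hconv.segment_subset hx hy
  have hsc : Convex ℝ (segment ℝ x y) := convex_segment x y
  have hcomp : IsCompact (segment ℝ x y) := by
    rw [segment_eq_image_lineMap]
    exact isCompact_Icc.image (by fun_prop)
  have hxs : x ∈ segment ℝ x y := left_mem_segment ℝ x y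
  have hys : y ∈ segment ℝ x y := right_mem_segment ℝ x y
  have hM0 : 0 ≤ M := (norm_nonneg _).trans (hM x hxs)
  obtain ⟨u, hu, humax⟩ := hcomp.exists_isMaxOn ⟨x, hxs⟩ ((hf.continuousOn.mono hsub).norm)
  have hmax : ∀ w ∈ segment ℝ x y, ‖f w‖ ≤ ‖f u‖ := fun w hw => humax hw
  have hpos : 0 < ‖f u‖ := (norm_pos_iff.2 hfv).trans_le (hmax v hv)
  have hle : ∀ w ∈ segment ℝ x y, ‖w - x‖ ≤ ‖y - x‖ := fun w hw =>
    norm_sub_le_of_mem_segment hw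
  have hf1 : ∀ w ∈ U, HasDerivAt f (deriv f w) w := fun w hw =>
    (hf.differentiableAt (hU.mem_nhds hw)).hasDerivAt
  have hf2 : ∀ w ∈ U, HasDerivAt (deriv f) (-(a w * f w)) w := fun w hw => by
    have h := ((hf.deriv hU).differentiableAt (hU.mem_nhds hw)).hasDerivAt
    have h2 := hode w hw
    rw [iteratedDeriv_succ, iteratedDeriv_one] at h2
    rwa [eq_neg_of_add_eq_zero_left h2] at h
  set K := M * ‖f u‖ * ‖y - x‖ with hK
  have h1 : ∀ w ∈ segment ℝ x y, ‖deriv f w - deriv f x‖ ≤ K := fun w hw => by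
    have h := hsc.norm_image_sub_le_of_norm_hasDerivWithin_le (C := M * ‖f u‖)
      (fun w hw => (hf2 w (hsub hw)).hasDerivWithinAt)
      (fun w hw => by
        rw [norm_neg, norm_mul]
        exact mul_le_mul (hM w hw) (hmax w hw) (norm_nonneg _) hM0) hxs hw
    exact h.trans (mul_le_mul_of_nonneg_left (hle w hw) (by positivity))
  have h2 : ∀ w ∈ segment ℝ x y, ‖f w - deriv f x * (w - x)‖ ≤ K * ‖w - x‖ := fun w hw => by
    have h := hsc.norm_image_sub_le_of_norm_hasDerivWithin_le (C := K)
      (f := fun w => f w - deriv f x * (w - x)) (f' := fun w => deriv f w - deriv f x * 1)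
      (fun w hw => ((hf1 w (hsub hw)).sub
        (((hasDerivAt_id w).sub_const x).const_mul _)).hasDerivWithinAt)
      (fun w hw => by rw [mul_one]; exact h1 w hw) hxs hw
    simpa [hfx] using h
  have h3 : ‖deriv f x‖ * ‖y - x‖ ≤ K * ‖y - x‖ := by
    simpa [hfy] using h2 y hys
  have h4 : ‖f u‖ ≤ 2 * M * ‖y - x‖ ^ 2 * ‖f u‖ := by
    have e1 : ‖f u‖ ≤ ‖f u - deriv f x * (u - x)‖ + ‖deriv f x * (u - x)‖ := by
      simpa using norm_add_le (f u - deriv f x * (u - x)) (deriv f x * (u - x))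
    have e2 : ‖f u - deriv f x * (u - x)‖ ≤ K * ‖y - x‖ :=
      (h2 u hu).trans (mul_le_mul_of_nonneg_left (hle u hu) (by positivity))
    have e3 : ‖deriv f x * (u - x)‖ ≤ K * ‖y - x‖ := by
      rw [norm_mul]
      exact (mul_le_mul_of_nonneg_left (hle u hu) (norm_nonneg _)).trans h3
    calc ‖f u‖ ≤ K * ‖y - x‖ + K * ‖y - x‖ := e1.trans (add_le_add e2 e3)
      _ = _ := by rw [hK]; ring
  exact le_of_mul_le_mul_right (by simpa using h4) hpos

theorem norm_le_maxModulus {a : ℂ → ℂ} (ha : DifferentiableOn ℂ a (Metric.ball 0 1)) {r : ℝ}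
    (hr0 : 0 < r) (hr1 : r < 1) {w : ℂ} (hw : ‖w‖ ≤ r) : ‖a w‖ ≤ maxModulus r a := by
  have hsub : Metric.closedBall (0 : ℂ) r ⊆ Metric.ball 0 1 := Metric.closedBall_subset_ball hr1
  have hd : DiffContOnCl ℂ a (Metric.ball 0 r) := by
    apply DifferentiableOn.diffContOnCl
    rw [closure_ball _ hr0.ne']
    exact ha.mono hsub
  have hbdd : BddAbove ((fun w => ‖a w‖) '' Metric.sphere (0 : ℂ) r) :=
    ((isCompact_sphere 0 r).image_of_continuousOn
      ((ha.continuousOn.mono (Metric.sphere_subset_closedBall.trans hsub)).norm)).bddAbove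
  refine Complex.norm_le_of_forall_mem_frontier_norm_le Metric.isBounded_ball hd ?_ ?_
  · intro u hu
    rw [frontier_ball _ hr0.ne'] at hu
    exact le_csSup hbdd ⟨u, hu, rfl⟩
  · rw [closure_ball _ hr0.ne']
    simpa using hw

/-! ### The sequence of pairs -/

namespace PairSequence

/-- The distance from the first member of the `n`-th pair to the point `1`. -/
noncomputable def s (n : ℕ) : ℝ := (1 / 4) ^ (n + 1)

/-- The logarithmic scale `log (1 / s n)` of the `n`-th pair. -/
noncomputable def L (n : ℕ) : ℝ := Real.log (1 / s n)

/-- The distance between the two members of the `n`-th pair; the parameter `η` is the `η₂` of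
the construction. The factor `4` makes `d η n ≤ s n ^ 4`, so that the pairs stay far apart compared
with their own width. -/
noncomputable def d (η : ℝ) (n : ℕ) : ℝ := Real.exp (-(4 * L n ^ (1 + η)))

/-- The sequence of pairs on the real axis: the terms of index `2 * n` and `2 * n + 1` form the
`n`-th pair. -/
noncomputable def p (η : ℝ) (k : ℕ) : ℝ := 1 - s (k / 2) + (k % 2 : ℕ) * d η (k / 2)

variable {η : ℝ}

theorem s_pos (n : ℕ) : 0 < s n := by unfold s; positivity

theorem s_le (n : ℕ) : s n ≤ 1 / 4 := by
  unfold s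
  exact pow_le_of_le_one (by norm_num) (by norm_num) (by omega)

theorem s_lt {m n : ℕ} (h : m < n) : s n ≤ s m / 4 := by
  have h1 : s n ≤ s (m + 1) := by
    unfold s
    exact pow_le_pow_of_le_one (by norm_num) (by norm_num) (by omega)
  have h2 : s (m + 1) = s m / 4 := by unfold s; ring
  linarith

theorem tendsto_s : Tendsto s atTop (𝓝 0) :=
  (tendsto_add_atTop_iff_nat 1).2
    (tendsto_pow_atTop_nhds_zero_of_lt_one (by norm_num) (by norm_num))

theorem one_le_log {t : ℝ} (ht : 0 < t) (h : t ≤ 1 / 4) : 1 ≤ Real.log (1 / t) := by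
  have h4 : (4 : ℝ) ≤ 1 / t := by
    rw [le_div_iff₀ ht]; linarith
  rw [Real.le_log_iff_exp_le (by positivity)]
  linarith [Real.exp_one_lt_d9]

theorem one_le_L (n : ℕ) : 1 ≤ L n := one_le_log (s_pos n) (s_le n)

theorem exp_neg_L (n : ℕ) : Real.exp (-L n) = s n := by
  rw [L, one_div, Real.log_inv, neg_neg, Real.exp_log (s_pos n)]

theorem d_pos (n : ℕ) : 0 < d η n := Real.exp_pos _

theorem d_le (hη : 0 < η) (n : ℕ) : d η n ≤ s n / 64 := by
  have h1 : L n ≤ L n ^ (1 + η) :=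
    Real.self_le_rpow_of_one_le (one_le_L n) (by linarith)
  have h2 : d η n ≤ s n ^ 4 := by
    rw [d, ← exp_neg_L, ← Real.exp_nat_mul]
    apply Real.exp_le_exp.2
    push_cast
    linarith
  have h3 : s n ^ 3 ≤ (1 / 4) ^ 3 := pow_le_pow_left₀ (s_pos n).le (s_le n) 3
  nlinarith [s_pos n]

theorem le_p (k : ℕ) : 1 - s (k / 2) ≤ p η k := by
  have := d_pos (η := η) (k / 2)
  unfold p
  nlinarith [Nat.cast_nonneg (α := ℝ) (k % 2)]

theorem p_le (hη : 0 < η) (k : ℕ) : p η k ≤ 1 - s (k / 2) + s (k / 2) / 64 := by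
  have h1 := d_pos (η := η) (k / 2)
  have h2 := d_le hη (k / 2)
  have h3 : ((k % 2 : ℕ) : ℝ) ≤ 1 := by
    exact_mod_cast Nat.lt_succ_iff.1 (Nat.mod_lt k (by norm_num))
  unfold p
  nlinarith

theorem p_pos (k : ℕ) : 0 < p η k := by
  linarith [le_p (η := η) k, s_le (k / 2)]

theorem p_lt_one (hη : 0 < η) (k : ℕ) : p η k < 1 := by
  linarith [p_le hη k, s_pos (k / 2)]

theorem norm_p (k : ℕ) : ‖(p η k : ℂ)‖ = p η k := by
  rw [Complex.norm_real, Real.norm_of_nonneg (p_pos k).le]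

theorem norm_p_sub (j k : ℕ) : ‖(p η j : ℂ) - p η k‖ = |p η j - p η k| := by
  rw [← Complex.ofReal_sub, Complex.norm_real, Real.norm_eq_abs]

/-- A point of the sequence within `(1 - p k) / 2` of `p k` belongs to the same pair. -/
theorem same_pair (hη : 0 < η) {j k : ℕ} (h : |p η j - p η k| ≤ (1 - p η k) / 2) :
    j / 2 = k / 2 := by
  have hj1 := le_p (η := η) j
  have hj2 := p_le hη j
  have hk1 := le_p (η := η) k
  have hk2 := p_le hη k
  have hsj := s_pos (j / 2)
  have hsk := s_pos (k / 2)
  obtain ⟨h1, h2⟩ := abs_le.1 h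
  rcases lt_trichotomy (j / 2) (k / 2) with hlt | heq | hlt
  · have := s_lt hlt
    linarith
  · exact heq
  · have := s_lt hlt
    linarith

theorem eq_of_abs_sub_lt {j k : ℕ} (hp : j / 2 = k / 2) (h : |p η j - p η k| < d η (k / 2)) :
    j = k := by
  by_contra hne
  have hd := d_pos (η := η) (k / 2)
  -- The two distinct members of a pair are at distance exactly `d η (k / 2)`.
  have hcases : (j % 2 = 0 ∧ k % 2 = 1) ∨ (j % 2 = 1 ∧ k % 2 = 0) := by omega
  obtain ⟨h1, h2⟩ := abs_lt.1 h
  unfold p at h1 h2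
  rw [hp] at h1 h2
  rcases hcases with ⟨e1, e2⟩ | ⟨e1, e2⟩ <;> rw [e1, e2] at h1 h2 <;> push_cast at h1 h2 <;>
    linarith

theorem p_injective (hη : 0 < η) : Function.Injective (p η) := fun j k h => by
  have h0 : |p η j - p η k| = 0 := by rw [h, sub_self, abs_zero]
  have hk := p_lt_one hη k
  refine eq_of_abs_sub_lt (η := η) (same_pair hη (by rw [h0]; linarith)) ?_
  rw [h0]
  exact d_pos _

theorem L_le_log (hη : 0 < η) (k : ℕ) : L (k / 2) ≤ Real.log (1 / (1 - p η k)) := by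
  have h1 := p_lt_one hη k
  have h2 := le_p (η := η) k
  exact Real.log_le_log (one_div_pos.2 (s_pos _))
    (one_div_le_one_div_of_le (by linarith) (by linarith))

theorem countIn_le_two (hη : 0 < η) (k : ℕ) {t : ℝ} (ht : t ≤ (1 - p η k) / 2) :
    countIn (fun k => (p η k : ℂ)) (p η k) t ≤ 2 := by
  have hsub : {j : ℕ | ‖(p η j : ℂ) - p η k‖ ≤ t} ⊆ {2 * (k / 2), 2 * (k / 2) + 1} := by
    intro j hj
    rw [mem_ofPred_eq, norm_p_sub] at hj
    have := same_pair hη (hj.trans ht)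
    simp only [mem_insert_iff, mem_singleton_iff]
    omega
  exact (encard_le_encard hsub).trans (encard_pair (by omega)).le

theorem countIn_le_one (hη : 0 < η) (k : ℕ) {t : ℝ} (ht : t ≤ (1 - p η k) / 2)
    (htd : t < d η (k / 2)) : countIn (fun k => (p η k : ℂ)) (p η k) t ≤ 1 := by
  have hsub : {j : ℕ | ‖(p η j : ℂ) - p η k‖ ≤ t} ⊆ {k} := by
    intro j hj
    rw [mem_ofPred_eq, norm_p_sub] at hj
    exact eq_of_abs_sub_lt (same_pair hη (hj.trans ht)) (hj.trans_lt htd)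
  exact (encard_le_encard hsub).trans (encard_singleton _).le

/-- Below `d η (k / 2)` the integrand vanishes, since only `p η k` itself is counted, and above it
the integrand is at most `1 / t`. -/
theorem integratedCount_le (hη : 0 < η) (k : ℕ) :
    integratedCount (fun k => (p η k : ℂ)) (p η k) ((1 - p η k) / 2) ≤
      ENNReal.ofReal (4 * L (k / 2) ^ (1 + η)) := by
  have hd := d_pos (η := η) (k / 2)
  have hd1 : d η (k / 2) ≤ 1 := by
    linarith [d_le hη (k / 2), s_le (k / 2)]
  have hR : (1 - p η k) / 2 ≤ 1 := by linarith [p_pos (η := η) k]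
  have hint : IntegrableOn (fun t : ℝ => t⁻¹) (Icc (d η (k / 2)) 1) :=
    (continuousOn_id.inv₀ fun t ht => (hd.trans_le ht.1).ne').integrableOn_Icc
  calc integratedCount (fun k => (p η k : ℂ)) (p η k) ((1 - p η k) / 2)
      ≤ ∫⁻ t in Ioc 0 ((1 - p η k) / 2),
          (Icc (d η (k / 2)) 1).indicator (fun t => ENNReal.ofReal t⁻¹) t := by
        refine setLIntegral_mono' measurableSet_Ioc fun t ht => ?_
        rcases lt_or_ge t (d η (k / 2)) with htd | htd
        · have h1 : (countIn (fun k => (p η k : ℂ)) (p η k) t : ℝ≥0∞) ≤ 1 := by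
            exact_mod_cast countIn_le_one hη k ht.2 htd
          rw [tsub_eq_zero_of_le h1, ENNReal.zero_div]
          exact zero_le
        · have h2 : (countIn (fun k => (p η k : ℂ)) (p η k) t : ℝ≥0∞) - 1 ≤ 1 := by
            rw [tsub_le_iff_right, one_add_one_eq_two]
            exact_mod_cast countIn_le_two hη k ht.2
          rw [indicator_of_mem (mem_Icc.2 ⟨htd, ht.2.trans hR⟩), ENNReal.ofReal_inv_of_pos ht.1,
            ← one_div]
          exact ENNReal.div_le_div_right h2 _
    _ ≤ ∫⁻ t, (Icc (d η (k / 2)) 1).indicator (fun t => ENNReal.ofReal t⁻¹) t :=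
        setLIntegral_le_lintegral _ _
    _ = ∫⁻ t in Icc (d η (k / 2)) 1, ENNReal.ofReal t⁻¹ :=
        lintegral_indicator measurableSet_Icc _
    _ = ENNReal.ofReal (∫ t in Icc (d η (k / 2)) 1, t⁻¹) := by
        rw [ofReal_integral_eq_lintegral_ofReal hint]
        exact (ae_restrict_iff' measurableSet_Icc).2
          (Eventually.of_forall fun t ht => inv_nonneg.2 (hd.le.trans ht.1))
    _ = ENNReal.ofReal (4 * L (k / 2) ^ (1 + η)) := by
        rw [integral_Icc_eq_integral_Ioc, ← intervalIntegral.integral_of_le hd1,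
          integral_inv_of_pos hd one_pos, one_div, Real.log_inv, d, Real.log_exp, neg_neg]

/-! ### Growth of the coefficient -/

/-- The `n`-th pair forces a large coefficient on the circle of radius `1 - s n / 2`. -/
theorem le_log_maxModulus (hη : 0 < η) {a f : ℂ → ℂ}
    (ha : DifferentiableOn ℂ a (Metric.ball 0 1)) (hf : IsDiscSolution a f)
    (hz : HasZeroSequence f (fun k => (p η k : ℂ))) (n : ℕ) :
    L n ^ (1 + η) ≤ Real.log (maxModulus (1 - s n / 2) a) := by
  have hs := s_pos n
  have hs4 := s_le n
  have hd := d_pos (η := η) n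
  have hds := d_le hη n
  have hL : 1 ≤ L n ^ (1 + η) := Real.one_le_rpow (one_le_L n) (by linarith)
  have hx : p η (2 * n) = 1 - s n := by
    simp [p]
  have hy : p η (2 * n + 1) = 1 - s n + d η n := by
    have h1 : (2 * n + 1) / 2 = n := by omega
    have h2 : (2 * n + 1) % 2 = 1 := by omega
    rw [p, h1, h2]; simp
  have hmem : ∀ k, (p η k : ℂ) ∈ {w ∈ Metric.ball (0 : ℂ) 1 | f w = 0} := fun k => by
    rw [hz]; exact mem_range_self k
  obtain ⟨hxU, hfx⟩ := hmem (2 * n)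
  obtain ⟨hyU, hfy⟩ := hmem (2 * n + 1)
  have hxy : ‖(p η (2 * n + 1) : ℂ) - p η (2 * n)‖ = d η n := by
    rw [norm_p_sub, hx, hy, add_sub_cancel_left, abs_of_pos hd]
  have hseg : segment ℝ (p η (2 * n) : ℂ) (p η (2 * n + 1)) ⊆
      Metric.closedBall 0 (1 - s n / 2) := by
    refine (convex_closedBall _ _).segment_subset ?_ ?_
    · rw [mem_closedBall_zero_iff, norm_p, hx]; linarith
    · rw [mem_closedBall_zero_iff, norm_p, hy]; linarith
  -- The segment is uncountable, so it contains a point that is not a zero of `f`.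
  obtain ⟨v, hv, hfv⟩ : ∃ v ∈ segment ℝ (p η (2 * n) : ℂ) (p η (2 * n + 1)), f v ≠ 0 := by
    by_contra! hcon
    have hsub : segment ℝ (p η (2 * n) : ℂ) (p η (2 * n + 1)) ⊆
        range (fun k => (p η k : ℂ)) := fun w hw => by
      rw [← hz]
      exact ⟨(convex_ball _ _).segment_subset hxU hyU hw, hcon w hw⟩
    have hinj : Function.Injective (AffineMap.lineMap (k := ℝ) (p η (2 * n) : ℂ)
        (p η (2 * n + 1) : ℂ)) := by
      apply AffineMap.lineMap_injective
      intro h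
      rw [← h, sub_self, norm_zero] at hxy
      exact hd.ne hxy
    have hc := (countable_range (fun k => (p η k : ℂ))).mono hsub
    rw [segment_eq_image_lineMap] at hc
    exact Cardinal.Real.Icc_countable_iff.1 (countable_of_injective_of_countable_image
      hinj.injOn hc) |>.not_gt one_pos
  have key := one_le_of_two_zeros Metric.isOpen_ball (convex_ball (0 : ℂ) 1) hf.1 hf.2 hxU hyU
    hfx hfy (M := maxModulus (1 - s n / 2) a)
    (fun w hw => norm_le_maxModulus ha (by linarith) (by linarith)
      (mem_closedBall_zero_iff.1 (hseg hw))) hv hfv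
  rw [hxy] at key
  have hMpos : 0 < maxModulus (1 - s n / 2) a := by
    by_contra! hcon
    nlinarith [sq_nonneg (d η n)]
  have hlog := Real.log_nonneg key
  rw [Real.log_mul (by positivity) (by positivity), Real.log_mul (by norm_num) hMpos.ne',
    Real.log_pow, d, Real.log_exp] at hlog
  push_cast at hlog
  linarith [Real.log_two_lt_d9]

theorem not_logMaxModulusBigO (hη : 0 < η) {a f : ℂ → ℂ}
    (ha : DifferentiableOn ℂ a (Metric.ball 0 1)) (hf : IsDiscSolution a f)
    (hz : HasZeroSequence f (fun k => (p η k : ℂ))) {θ : ℝ} (hθ : θ < η) :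
    ¬ LogMaxModulusBigO a (1 + θ) := by
  rintro ⟨C, hC, hbig⟩
  have hs0 : Tendsto (fun n => s n / 2) atTop (𝓝[>] 0) := by
    refine tendsto_nhdsWithin_iff.2 ⟨by simpa using tendsto_s.div_const 2, ?_⟩
    exact Eventually.of_forall fun n => half_pos (s_pos n)
  have hr : Tendsto (fun n => 1 - s n / 2) atTop (𝓝[<] 1) := by
    refine tendsto_nhdsWithin_iff.2 ⟨by simpa using (tendsto_s.div_const 2).const_sub 1, ?_⟩
    exact Eventually.of_forall fun n => sub_lt_self _ (half_pos (s_pos n))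
  have hT : Tendsto (fun n => Real.log (1 / (s n / 2)) ^ (η - θ)) atTop atTop := by
    refine (tendsto_rpow_atTop (sub_pos.2 hθ)).comp (Real.tendsto_log_atTop.comp ?_)
    simp only [one_div]
    exact hs0.inv_tendsto_nhdsGT_zero
  obtain ⟨n, hn, hTn⟩ := ((hr.eventually hbig).and
    (hT.eventually_gt_atTop (C * 2 ^ (1 + η)))).exists
  rw [sub_sub_cancel] at hn
  set T := Real.log (1 / (s n / 2)) with hTdef
  have hL := one_le_L n
  have hTL : T = L n + Real.log 2 := by
    rw [hTdef, L, ← Real.log_mul (one_div_pos.2 (s_pos n)).ne' (by norm_num)]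
    congr 1
    field_simp
  have h2 := Real.log_two_lt_d9
  have hT0 : 0 < T := by rw [hTL]; linarith [Real.log_two_gt_d9]
  -- `T` is at most `2 * L n`, which bounds `T ^ (1 + η)` by `2 ^ (1 + η) * C * T ^ (1 + θ)`.
  have h3 : T ^ (1 + η) ≤ 2 ^ (1 + η) * L n ^ (1 + η) := by
    rw [← Real.mul_rpow (by norm_num) (by linarith)]
    exact Real.rpow_le_rpow hT0.le (by linarith) (by linarith)
  have h4 : L n ^ (1 + η) ≤ C * T ^ (1 + θ) := (le_log_maxModulus hη ha hf hz n).trans hn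
  have h5 : T ^ (1 + η) = T ^ (η - θ) * T ^ (1 + θ) := by
    rw [← Real.rpow_add hT0]; ring_nf
  have h6 : C * 2 ^ (1 + η) * T ^ (1 + θ) < T ^ (η - θ) * T ^ (1 + θ) :=
    mul_lt_mul_of_pos_right hTn (Real.rpow_pos_of_pos hT0 _)
  have h7 : (2 : ℝ) ^ (1 + η) * L n ^ (1 + η) ≤ 2 ^ (1 + η) * (C * T ^ (1 + θ)) :=
    mul_le_mul_of_nonneg_left h4 (by positivity)
  rw [← h5] at h6
  linarith

end PairSequence

theorem mainTheorem4 (η₁ η₂ : ℝ) (hη₁ : 0 < η₁) (hη₂ : 0 < η₂) :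
    ∃ z : ℕ → ℂ, Function.Injective z ∧ (∀ k, z k ∈ Metric.ball (0 : ℂ) 1) ∧
      (∃ C : ℝ, 0 < C ∧ ∀ k,
        (countIn z (z k) ((1 - ‖z k‖) / 2) : ℝ≥0∞) ≤
          ENNReal.ofReal (C * Real.log (1 / (1 - ‖z k‖)) ^ η₁)) ∧
      (∃ C : ℝ, 0 < C ∧ ∀ k,
        integratedCount z (z k) ((1 - ‖z k‖) / 2) ≤
          ENNReal.ofReal (C * Real.log (1 / (1 - ‖z k‖)) ^ (1 + η₁ + η₂))) ∧
      ∀ η : ℝ, η < η₂ →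
        ¬ ∃ a f : ℂ → ℂ, DifferentiableOn ℂ a (Metric.ball 0 1) ∧
          LogMaxModulusBigO a (1 + η) ∧ IsDiscSolution a f ∧ HasZeroSequence f z := by
  refine ⟨fun k => (PairSequence.p η₂ k : ℂ),
    Complex.ofReal_injective.comp (PairSequence.p_injective hη₂), fun k => ?_,
    ⟨2, two_pos, fun k => ?_⟩, ⟨4, four_pos, fun k => ?_⟩, ?_⟩
  · rw [mem_ball_zero_iff, PairSequence.norm_p]
    exact PairSequence.p_lt_one hη₂ k
  · have hlog := (PairSequence.one_le_L (k / 2)).trans (PairSequence.L_le_log hη₂ k)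
    have h1 := Real.one_le_rpow hlog hη₁.le
    rw [PairSequence.norm_p]
    calc (countIn (fun k => (PairSequence.p η₂ k : ℂ)) (PairSequence.p η₂ k)
          ((1 - PairSequence.p η₂ k) / 2) : ℝ≥0∞) ≤ 2 := by
          exact_mod_cast PairSequence.countIn_le_two hη₂ k le_rfl
      _ = ENNReal.ofReal 2 := by simp
      _ ≤ _ := ENNReal.ofReal_le_ofReal (by linarith)
  · have hL := PairSequence.one_le_L (k / 2)
    have hlog := PairSequence.L_le_log hη₂ k
    rw [PairSequence.norm_p]
    refine (PairSequence.integratedCount_le hη₂ k).trans (ENNReal.ofReal_le_ofReal ?_)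
    refine mul_le_mul_of_nonneg_left ?_ (by norm_num)
    exact (Real.rpow_le_rpow (by linarith) hlog (by linarith)).trans
      (Real.rpow_le_rpow_of_exponent_le (hL.trans hlog) (by linarith))
  · rintro η hη ⟨a, f, ha, hbig, hf, hz⟩
    exact PairSequence.not_logMaxModulusBigO hη₂ ha hf hz hη hbig
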